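/- **Theorem 3.1.** Let $\varepsilon$ be a random variable on a sublinear expectation space $(\Omega_0,\mathcal H,\mathbb E)$ (that is, $\mathcal H$ is a linear space of real functions on $\Omega_0$ containing the constants, and $\mathbb E:\mathcal H\to\mathbb R$ is monotone, constant preserving, sub-additive and positively homogeneous) with $\varepsilon,\varepsilon^2\in\mathcal H$, and suppose that $\varepsilon$ is mean-certain with mean zero, i.e. $\mathbb E[\varepsilon]=-\mathbb E[-\varepsilon]=0$; its variance may be uncertain. Let $m\ge 1$ be fixed and let $F_1,\dots,F_m$ be probability distributions on $\mathbb R$ that are possible distributions of $\varepsilon$, i.e. $E_{F_i}[g]$ exists and $E_{F_i}[g]\le\mathbb E[g(\varepsilon)]$ for every measurable $g$ with $g(\varepsilon)\in\mathcal H$. Put $\sigma_i^2=\int t^2\,dF_i(t)$ and assume that for some $i_*$ one has $\sigma_{i_*}^2>\sigma_i^2$ for all $i\ne i_*$. Let $F_{\mathbf x}$ be a probability distribution on $\mathbb R^p$ with finite second moments such that, for $\mathbf x\sim F_{\mathbf x}$, the matrix $E[\mathbf x\mathbf x']$ is positive definite. Let $\mathcal B\subseteq\mathbb R^p$ be a parameter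 set that contains the true parameter $\beta$ in its interior (for instance $\mathcal B=\mathbb R^p$). Consider a sequence of samples, each consisting of $m$ blocks of $n$ observations $$Y_{ij}=\beta'\mathbf x_{ij}+\varepsilon_{ij},\qquad 1\le i\le m,\ 1\le j\le n,$$ with total sample size $N=mn$ and $n\to\infty$, the samples being defined on (possibly different) classical probability spaces, such that in each sample - the covariates $\mathbf x_{ij}$ are i.i.d. with distribution $F_{\mathbf x}$; - (C1) for each $i$, the errors $\varepsilon_{i1},\dots,\varepsilon_{in}$ are independent with common distribution $F_i$ (nothing is assumed about the dependence between errors of different blocks); - the family $(\varepsilon_{ij})$ is independent of the family $(\mathbf x_{ij})$. Let $\hat\beta_G$ be a mini-max estimator, that is, a measurable function on the sample space which almost surely satisfies $$\hat\beta_G\in\mathop{\arg\min}_{b\in\mathcal B}\ \max_{1\le i\le m}\frac1n\sum_{j=1}^n\bigl(Y_{ij}-b'\mathbf x_{ij}\bigr)^2 .$$ Then, as $N\to\infty$ (and hence $n\to\infty$), $$\sqrt n\,(\hat\beta_G-\beta)\ \stackrel{d}{\longrightarrow}\ N\bigl(0,\ \sigma_{i_*}^2\,(E[\mathbf x\mathbf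 x'])^{-1}\bigr).$$ -/

import Mathlib

open Filter MeasureTheory ProbabilityTheory

/-- A sublinear expectation on a set `Ω`: a linear space `space` of real functions on `Ω` that
contains the constants, and a monotone, constant preserving, sub-additive and positively
homogeneous functional `expect` on it. -/
structure SublinearExpectation (Ω : Type*) where
  space : Submodule ℝ (Ω → ℝ)
  expect : space → ℝ
  const_mem : ∀ c : ℝ, (fun _ : Ω => c) ∈ space
  monotone' : ∀ U V : space, (∀ ω, (V : Ω → ℝ) ω ≤ (U : Ω → ℝ) ω) → expect V ≤ expect U
  expect_const : ∀ c : ℝ, expect ⟨fun _ => c, const_mem c⟩ = c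
  expect_add_le : ∀ U V : space, expect (U + V) ≤ expect U + expect V
  expect_smul : ∀ (c : ℝ) (U : space), 0 ≤ c → expect (c • U) = c * expect U

namespace SublinearExpectation

variable {Ω : Type*} (𝔼 : SublinearExpectation Ω)

/-- The upper mean `𝔼[ε]`. -/
def upperMean (ε : 𝔼.space) : ℝ := 𝔼.expect ε

/-- The lower mean `-𝔼[-ε]`. -/
def lowerMean (ε : 𝔼.space) : ℝ := -𝔼.expect (-ε)

/-- The error `ε` is mean-certain and centred: the mean-uncertainty interval
`[lowerMean ε, upperMean ε]` is reduced to the point `0`. Its variance may be uncertain. -/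
def IsMeanCertain (ε : 𝔼.space) : Prop := 𝔼.lowerMean ε = 0 ∧ 𝔼.upperMean ε = 0

/-- `F` is one of the possible distributions of `ε`, i.e. the distribution of `ε` under one of the
linear expectations whose upper envelope is `𝔼`: the `F`-expectation of `g` is defined and is at
most `𝔼[g(ε)]`, for every measurable `g` such that `g(ε)` is in the domain of `𝔼`. -/
def IsPossibleLaw (ε : 𝔼.space) (F : Measure ℝ) : Prop :=
  ∀ g : ℝ → ℝ, Measurable g → ∀ hg : (fun ω => g ((ε : Ω → ℝ) ω)) ∈ 𝔼.space,
    Integrable g F ∧ ∫ t, g t ∂F ≤ 𝔼.expect ⟨fun ω => g ((ε : Ω → ℝ) ω), hg⟩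

end SublinearExpectation

/-- The matrix `E[xx']` for a random vector `x` with distribution `ν`. -/
noncomputable def secondMomentMatrix {p : ℕ} (ν : Measure (EuclideanSpace ℝ (Fin p))) :
    Matrix (Fin p) (Fin p) ℝ :=
  Matrix.of fun a b => ∫ v, v a * v b ∂ν

/-- The mean squared residual `(1/n) ∑ⱼ (yⱼ - b'xⱼ)²` of one block of `n` observations. -/
noncomputable def blockLoss {p n : ℕ} (y : Fin n → ℝ) (x : Fin n → EuclideanSpace ℝ (Fin p))
    (b : EuclideanSpace ℝ (Fin p)) : ℝ :=
  (1 / (n : ℝ)) * ∑ j, (y j - inner ℝ b (x j)) ^ 2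

/-- The maximum over the `m` blocks of the block mean squared residual (a maximum of finitely many
real numbers, used for `m ≥ 1`). -/
noncomputable def maxBlockLoss {p m n : ℕ} (y : Fin m → Fin n → ℝ)
    (x : Fin m → Fin n → EuclideanSpace ℝ (Fin p)) (b : EuclideanSpace ℝ (Fin p)) : ℝ :=
  ⨆ i, blockLoss (y i) (x i) b

/-- `b` is a mini-max estimate over the parameter set `B`: an element of `B` at which the maximal
block mean squared residual is minimal over `B`. -/
def IsMinimaxEstimate {p m n : ℕ} (B : Set (EuclideanSpace ℝ (Fin p))) (y : Fin m → Fin n → ℝ)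
    (x : Fin m → Fin n → EuclideanSpace ℝ (Fin p)) (b : EuclideanSpace ℝ (Fin p)) : Prop :=
  b ∈ B ∧ IsMinOn (maxBlockLoss y x) B b

/-- The variance `σ² = E_F[ε²]` of a (centred) error with distribution `F`. -/
noncomputable def errorVariance (F : Measure ℝ) : ℝ := ∫ t, t ^ 2 ∂F

/-!
Expanding the squares, the mean squared residual of block `i` at `b = β + δ` is the quadratic
function `S i - 2 ⟪δ, Z i⟫ + ⟪δ, A i δ⟫` of `δ`, where `S i`, `Z i` and `A i` are the block averages
of `e²`, `e x` and `x ⊗ x`. Possible laws of a mean-certain centred error have mean zero, so by the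
law of large numbers these coefficients tend in probability to `errorVariance (F i)`, `0` and the
second moment operator `A` of the covariates; only finitely many blocks are involved, so nothing is
needed about the dependence between them.

Once the coefficients are close to their limits, the mini-max error is exactly the least squares error
`(A iStar)⁻¹ (Z iStar)` of the block with the largest variance
(`exists_forall_minimizer_eq_ringInverse`): the gap between the variances makes the loss of
that block the maximal one on a fixed ball around `0`, this ball contains the least squares error and
is contained in the translated parameter set, and outside the ball the loss of that block still
bounds the maximum from below. Strict convexity then leaves no other minimizer.

The least squares error of one block depends only on an i.i.d. sample of pairs `(x, e)`. Its law is
therefore that of the same function of the first `n` terms of a fixed i.i.d. sequence, where the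
central limit theorem for `e x` and Slutsky's theorem apply
(`tendstoInDistribution_ringInverse_sampleMean`). The covariance of `e x` is
`errorVariance (F iStar) • A`, and applying `A⁻¹` yields the covariance of the limit.
-/

/-! ### Minimizing a maximum of quadratic functions -/

section Deterministic

variable {V : Type*} [NormedAddCommGroup V] [InnerProductSpace ℝ V]

/-- The quadratic function `δ ↦ s - 2 ⟪δ, z⟫ + ⟪δ, A δ⟫` with coefficients `c = (s, z, A)`. -/
def quadraticLoss (c : ℝ × V × (V →L[ℝ] V)) (δ : V) : ℝ :=
  c.1 - 2 * inner ℝ δ c.2.1 + inner ℝ δ (c.2.2 δ)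

theorem exists_pos_forall_mul_sq_le_inner [FiniteDimensional ℝ V] (A : V →L[ℝ] V)
    (hA : ∀ v, v ≠ 0 → 0 < inner ℝ v (A v)) :
    ∃ l > 0, ∀ v, l * ‖v‖ ^ 2 ≤ inner ℝ v (A v) := by
  obtain ⟨l, hl, h⟩ := (isCompact_sphere (0 : V) 1).exists_forall_le'
    (f := fun v => inner ℝ v (A v)) (a := 0) (by fun_prop)
    (fun v hv => hA v (by rintro rfl; simp at hv))
  refine ⟨l, hl, fun v => ?_⟩
  by_cases hv : v = 0
  · simp [hv]
  have hv' : ‖v‖ ≠ 0 := by simpa using hv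
  have := h (‖v‖⁻¹ • v) (by simp [norm_smul, hv'])
  simp only [map_smul, real_inner_smul_left, real_inner_smul_right] at this
  calc l * ‖v‖ ^ 2 ≤ (‖v‖⁻¹ * (‖v‖⁻¹ * inner ℝ v (A v))) * ‖v‖ ^ 2 := by gcongr
    _ = inner ℝ v (A v) := by field_simp

theorem ContinuousLinearMap.isUnit_of_forall_mul_sq_le_inner [FiniteDimensional ℝ V]
    {A : V →L[ℝ] V} {l : ℝ} (hl : 0 < l) (h : ∀ v, l * ‖v‖ ^ 2 ≤ inner ℝ v (A v)) :
    IsUnit A := by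
  have hinj : Function.Injective (A : V →ₗ[ℝ] V) := by
    rw [injective_iff_map_eq_zero]
    intro v hv
    have h1 := h v
    have h2 : A v = 0 := hv
    rw [h2, inner_zero_right] at h1
    have : ‖v‖ ^ 2 = 0 := le_antisymm (by nlinarith) (sq_nonneg _)
    simpa using this
  have := FiniteDimensional.complete ℝ V
  rw [ContinuousLinearMap.isUnit_iff_bijective]
  exact ⟨hinj, (LinearMap.injective_iff_surjective (f := (A : V →ₗ[ℝ] V))).1 hinj⟩

theorem ContinuousLinearMap.apply_ringInverse_apply {A : V →L[ℝ] V} (hA : IsUnit A) (v : V) :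
    A (Ring.inverse A v) = v := by
  have := congrArg (fun B : V →L[ℝ] V => B v) (Ring.mul_inverse_cancel A hA)
  simpa using this

theorem quadraticLoss_sub_quadraticLoss {c : ℝ × V × (V →L[ℝ] V)}
    (hsymm : ∀ u v, inner ℝ u (c.2.2 v) = inner ℝ (c.2.2 u) v) {d : V} (hd : c.2.2 d = c.2.1)
    (δ : V) :
    quadraticLoss c δ - quadraticLoss c d = inner ℝ (δ - d) (c.2.2 (δ - d)) := by
  have h : inner ℝ d (c.2.2 δ) = inner ℝ δ (c.2.2 d) := by rw [hsymm, real_inner_comm]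
  simp only [quadraticLoss, map_sub, inner_sub_left, inner_sub_right, ← hd]
  linarith

theorem abs_inner_apply_le (A : V →L[ℝ] V) (v : V) : |inner ℝ v (A v)| ≤ ‖A‖ * ‖v‖ ^ 2 := by
  calc |inner ℝ v (A v)| ≤ ‖v‖ * ‖A v‖ := abs_real_inner_le_norm _ _
    _ ≤ ‖v‖ * (‖A‖ * ‖v‖) := by gcongr; exact A.le_opNorm v
    _ = ‖A‖ * ‖v‖ ^ 2 := by ring

/-- A maximum of finitely many quadratic functions whose coefficients are close to `(s i, 0, A)`,
with `A` positive definite and `s i₀` strictly the largest constant term, can only be minimized at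
the unconstrained minimizer of the `i₀`-th one: near `0` the gap in the constant terms makes that
function the maximum, and everywhere else it is still a lower bound for the maximum. The set `D` need
not be convex. -/
theorem exists_forall_minimizer_eq_ringInverse [FiniteDimensional ℝ V] {ι : Type*} [Finite ι]
    {s : ι → ℝ} {A : V →L[ℝ] V} {i₀ : ι} (hs : ∀ i, i ≠ i₀ → s i < s i₀)
    (hA : ∀ v, v ≠ 0 → 0 < inner ℝ v (A v)) {D : Set V} (hD : D ∈ nhds 0) :
    ∃ η > 0, ∀ c : ι → ℝ × V × (V →L[ℝ] V), (∀ i, ‖c i - (s i, 0, A)‖ < η) →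
      (∀ u v, inner ℝ u ((c i₀).2.2 v) = inner ℝ ((c i₀).2.2 u) v) →
      ∀ δ ∈ D, IsMinOn (fun d => ⨆ i, quadraticLoss (c i) d) D δ →
        δ = Ring.inverse (c i₀).2.2 (c i₀).2.1 := by
  have : Nonempty ι := ⟨i₀⟩
  obtain ⟨l, hl, hAl⟩ := exists_pos_forall_mul_sq_le_inner A hA
  obtain ⟨r₀, hr₀, hball⟩ := Metric.mem_nhds_iff.1 hD
  obtain ⟨g, hg, hgap⟩ : ∃ g > 0, ∀ i, i ≠ i₀ → s i + g ≤ s i₀ := by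
    have h : ∀ᶠ g in nhdsWithin (0 : ℝ) (Set.Ioi 0), ∀ i, i ≠ i₀ → s i + g ≤ s i₀ := by
      refine eventually_all.2 fun i => ?_
      by_cases hi : i = i₀
      · simp [hi]
      filter_upwards [Ioo_mem_nhdsGT (sub_pos.2 (hs i hi))] with g hg _
      linarith [hg.2]
    obtain ⟨g, h1, h2⟩ := (h.and self_mem_nhdsWithin).exists
    exact ⟨g, h2, h1⟩
  set r := min r₀ 1
  have hr_pos : 0 < r := lt_min hr₀ one_pos
  have hr_one : r ≤ 1 := min_le_right _ _
  -- `g / 16` keeps `i₀` dominant on the ball of radius `r`, `l / 2` keeps the quadratic part of the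
  -- `i₀`-th function coercive, and `l * r / 8` puts its minimizer inside that ball.
  refine ⟨min (g / 16) (min (l / 2) (l * r / 8)), by positivity, fun c hc hsymm δ hδ hmin => ?_⟩
  set η := min (g / 16) (min (l / 2) (l * r / 8))
  have hηg : η ≤ g / 16 := min_le_left _ _
  have hηl : η ≤ l / 2 := (min_le_right _ _).trans (min_le_left _ _)
  have hηr : η ≤ l * r / 8 := (min_le_right _ _).trans (min_le_right _ _)
  have hη_pos : 0 < η := by positivity
  have hcs : ∀ i, |(c i).1 - s i| ≤ η := fun i => (norm_fst_le (c i - (s i, 0, A))).trans (hc i).le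
  have hcz : ∀ i, ‖(c i).2.1‖ ≤ η := fun i => by
    have h := ((norm_fst_le (c i - (s i, 0, A)).2).trans (norm_snd_le _)).trans (hc i).le
    simpa only [Prod.fst_sub, Prod.snd_sub, sub_zero] using h
  have hcA : ∀ i, ‖(c i).2.2 - A‖ ≤ η := fun i =>
    ((norm_snd_le (c i - (s i, 0, A)).2).trans (norm_snd_le _)).trans (hc i).le
  have hinz : ∀ i v, |inner ℝ v (c i).2.1| ≤ η * ‖v‖ := fun i v =>
    (abs_real_inner_le_norm _ _).trans (by rw [mul_comm]; gcongr; exact hcz i)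
  have hinA : ∀ i v, |inner ℝ v ((c i).2.2 v) - inner ℝ v (A v)| ≤ η * ‖v‖ ^ 2 := fun i v => by
    have h := abs_inner_apply_le ((c i).2.2 - A) v
    rw [sub_apply, inner_sub_right] at h
    exact h.trans (by gcongr; exact hcA i)
  have hcoer : ∀ v, l / 2 * ‖v‖ ^ 2 ≤ inner ℝ v ((c i₀).2.2 v) := fun v => by
    nlinarith [hAl v, (abs_le.1 (hinA i₀ v)).1, sq_nonneg ‖v‖]
  -- On the ball of radius `r`, the maximum is attained at `i₀`.
  have hmax : ∀ v, ‖v‖ ≤ r → ⨆ i, quadraticLoss (c i) v = quadraticLoss (c i₀) v := by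
    intro v hv
    refine le_antisymm (ciSup_le fun i => ?_)
      (le_ciSup (f := fun i => quadraticLoss (c i) v) (Set.finite_range _).bddAbove i₀)
    rcases eq_or_ne i i₀ with rfl | hi
    · rfl
    have h1 := abs_le.1 (hcs i)
    have h1' := abs_le.1 (hcs i₀)
    have h2 := abs_le.1 (hinz i v)
    have h2' := abs_le.1 (hinz i₀ v)
    have h3 := abs_le.1 (hinA i v)
    have h3' := abs_le.1 (hinA i₀ v)
    have hv1 : ‖v‖ ≤ 1 := hv.trans hr_one
    have h4 : η * ‖v‖ ≤ η := mul_le_of_le_one_right hη_pos.le hv1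
    have h5 : η * ‖v‖ ^ 2 ≤ η := mul_le_of_le_one_right hη_pos.le (pow_le_one₀ (norm_nonneg _) hv1)
    have h6 := hgap i hi
    simp only [quadraticLoss]
    linarith [h1.2, h1'.1, h2.1, h2'.2, h3.2, h3'.1]
  have hle : ∀ v, quadraticLoss (c i₀) v ≤ ⨆ i, quadraticLoss (c i) v := fun v =>
    le_ciSup (f := fun i => quadraticLoss (c i) v) (Set.finite_range _).bddAbove i₀
  have hmemD : ∀ v, ‖v‖ < r → v ∈ D := fun v hv =>
    hball (by simpa using hv.trans_le (min_le_left r₀ 1))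
  have hA_unit := ContinuousLinearMap.isUnit_of_forall_mul_sq_le_inner (half_pos hl) hcoer
  set d := Ring.inverse (c i₀).2.2 (c i₀).2.1
  have hd : (c i₀).2.2 d = (c i₀).2.1 := ContinuousLinearMap.apply_ringInverse_apply hA_unit _
  have hd_norm : ‖d‖ < r := by
    have h1 := hcoer d
    rw [hd] at h1
    have h2 := (abs_le.1 (hinz i₀ d)).2
    by_contra! h
    have h3 : η * ‖d‖ ≤ l * r / 8 * ‖d‖ := by gcongr
    have h4 : l * r * ‖d‖ ≤ l * ‖d‖ * ‖d‖ := by gcongr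
    nlinarith [mul_pos hl (pow_pos (hr_pos.trans_le h) 2)]
  -- `δ` may lie far from `0`, but there too the maximum is at least the loss at `i₀`.
  have hδd : quadraticLoss (c i₀) δ ≤ quadraticLoss (c i₀) d := by
    rw [← hmax d hd_norm.le]
    exact (hle δ).trans (hmin (hmemD d hd_norm))
  have h := hcoer (δ - d)
  rw [← quadraticLoss_sub_quadraticLoss hsymm hd δ] at h
  have h0 : ‖δ - d‖ ^ 2 = 0 := le_antisymm (by nlinarith) (sq_nonneg _)
  exact sub_eq_zero.1 (by simpa using h0)

end Deterministic

/-! ### Averages over independent samples -/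

section Sampling

variable {α : Type*} [MeasurableSpace α]

/-- The average `(1/n) ∑ⱼ f (zⱼ)` of `f` over a sample `z` of size `n` (it is `0` for `n = 0`). -/
noncomputable def sampleMean {G : Type*} [AddCommGroup G] [Module ℝ G] {n : ℕ} (f : α → G)
    (z : Fin n → α) : G :=
  (n : ℝ)⁻¹ • ∑ j, f (z j)

theorem measurable_sampleMean {G : Type*} [NormedAddCommGroup G] [NormedSpace ℝ G]
    [MeasurableSpace G] [BorelSpace G] [SecondCountableTopology G] {f : α → G} (hf : Measurable f)
    (n : ℕ) : Measurable (sampleMean f : (Fin n → α) → G) := by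
  unfold sampleMean
  fun_prop

variable (μ : Measure α) [IsProbabilityMeasure μ]

/-- An i.i.d. sample of size `n` has the law of the first `n` terms of one fixed i.i.d. sequence.
This carries limit theorems for a single sequence over to samples on varying probability spaces. -/
theorem map_restrict_infinitePi_eq_pi (n : ℕ) :
    (Measure.infinitePi fun _ : ℕ => μ).map (fun (ω : ℕ → α) (j : Fin n) => ω j) =
      Measure.pi fun _ => μ := by
  rw [← Measure.infinitePi_eq_pi]
  exact Measure.map_infinitePi_infinitePi_of_inj (P := fun _ : ℕ => μ) Fin.val_injective

variable {μ}

theorem integral_comp_eval_infinitePi {G : Type*} [NormedAddCommGroup G] [NormedSpace ℝ G]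
    {f : α → G} (hf : AEStronglyMeasurable f μ) (i : ℕ) :
    ∫ ω, f (ω i) ∂(Measure.infinitePi fun _ : ℕ => μ) = ∫ a, f a ∂μ := by
  have hmp := measurePreserving_eval_infinitePi (fun _ : ℕ => μ) i
  have h := integral_map hmp.measurable.aemeasurable (hmp.map_eq.symm ▸ hf)
  rw [hmp.map_eq] at h
  exact h.symm

theorem ae_tendsto_sampleMean {G : Type*} [NormedAddCommGroup G] [NormedSpace ℝ G]
    [CompleteSpace G] [MeasurableSpace G] [BorelSpace G]
    {f : α → G} (hf : Measurable f) (hint : Integrable f μ) :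
    ∀ᵐ ω ∂(Measure.infinitePi fun _ : ℕ => μ),
      Tendsto (fun n : ℕ => sampleMean f fun j : Fin n => ω j) atTop (nhds (∫ a, f a ∂μ)) := by
  have hmp := measurePreserving_eval_infinitePi (fun _ : ℕ => μ)
  have hind : iIndepFun (fun (i : ℕ) (ω : ℕ → α) => f (ω i)) (Measure.infinitePi fun _ => μ) :=
    iIndepFun_infinitePi fun _ => hf
  have h := strong_law_ae (fun (i : ℕ) (ω : ℕ → α) => f (ω i)) (μ := Measure.infinitePi fun _ => μ)
    ((hmp 0).integrable_comp_of_integrable hint) (fun i j hij => hind.indepFun hij)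
    (fun i => IdentDistrib.comp (f := fun ω : ℕ → α => ω i) (g := fun ω : ℕ → α => ω 0)
      ⟨(hmp i).measurable.aemeasurable, (hmp 0).measurable.aemeasurable,
        (hmp i).map_eq.trans (hmp 0).map_eq.symm⟩ hf)
  rw [integral_comp_eval_infinitePi hint.aestronglyMeasurable 0] at h
  filter_upwards [h] with ω hω
  simpa only [sampleMean, Fin.sum_univ_eq_sum_range (fun i => f (ω i))] using hω

/-- Weak law of large numbers, in terms of the laws of the samples only. -/
theorem tendsto_measure_le_norm_sampleMean_sub {G : Type*} [NormedAddCommGroup G]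
    [NormedSpace ℝ G] [CompleteSpace G] [MeasurableSpace G] [BorelSpace G]
    [SecondCountableTopology G] {f : α → G} (hf : Measurable f) (hint : Integrable f μ) {η : ℝ}
    (hη : 0 < η) :
    Tendsto (fun n : ℕ => (Measure.pi fun _ : Fin n => μ)
      {z | η ≤ ‖sampleMean f z - ∫ a, f a ∂μ‖}) atTop (nhds 0) := by
  have hmeas := measurable_sampleMean hf
  have h := tendstoInMeasure_of_tendsto_ae
    (f := fun (n : ℕ) (ω : ℕ → α) => sampleMean f fun j : Fin n => ω j) (g := fun _ => ∫ a, f a ∂μ)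
    (fun n => ((hmeas n).comp (by fun_prop)).aestronglyMeasurable)
    (ae_tendsto_sampleMean hf hint)
  rw [tendstoInMeasure_iff_norm] at h
  refine (h η hη).congr fun n => ?_
  rw [← map_restrict_infinitePi_eq_pi μ n, Measure.map_apply (by fun_prop)
    (measurableSet_le measurable_const (((hmeas n).sub_const _).norm))]
  rfl

/-- Pairing an i.i.d. sample with an independent i.i.d. sample gives an i.i.d. sample of pairs. -/
theorem ProbabilityTheory.iIndepFun.hasLaw_pi_prod {β Ω' : Type*} [MeasurableSpace β]
    [MeasurableSpace Ω']
    {P : Measure Ω'} [IsProbabilityMeasure P] {ρ : Measure β} [IsProbabilityMeasure ρ]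
    {ι : Type*} [Fintype ι] {X : ι → Ω' → α} {Y : ι → Ω' → β}
    (hX : iIndepFun X P) (hXμ : ∀ i, HasLaw (X i) μ P)
    (hY : iIndepFun Y P) (hYρ : ∀ i, HasLaw (Y i) ρ P)
    (hXY : IndepFun (fun ω i => X i ω) (fun ω i => Y i ω) P) :
    HasLaw (fun ω i => (X i ω, Y i ω)) (Measure.pi fun _ => μ.prod ρ) P where
  aemeasurable := aemeasurable_pi_iff.2 fun i => (hXμ i).aemeasurable.prodMk (hYρ i).aemeasurable
  map_eq := by
    have hXl := iIndepFun.hasLaw_pi hXμ hX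
    have hYl := iIndepFun.hasLaw_pi hYρ hY
    have h := (indepFun_iff_map_prod_eq_prod_map_map hXl.aemeasurable hYl.aemeasurable).1 hXY
    rw [hXl.map_eq, hYl.map_eq] at h
    rw [← (measurePreserving_arrowProdEquivProdArrow α β ι (fun _ => μ) (fun _ => ρ)).symm.map_eq,
      ← h, AEMeasurable.map_map_of_aemeasurable (by fun_prop)
        (hXl.aemeasurable.prodMk hYl.aemeasurable)]
    rfl

end Sampling

/-! ### Convergence in distribution on varying probability spaces -/

section Convergence

theorem MeasureTheory.TendstoInDistribution.congr_identDistrib {ι E Ω₀ Ω₀' : Type*}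
    {Ω₁ Ω₂ : ι → Type*}
    [∀ i, MeasurableSpace (Ω₁ i)] [∀ i, MeasurableSpace (Ω₂ i)] [MeasurableSpace Ω₀]
    [MeasurableSpace Ω₀'] [TopologicalSpace E] [MeasurableSpace E] [OpensMeasurableSpace E]
    {l : Filter ι}
    {P₁ : ∀ i, Measure (Ω₁ i)} [∀ i, IsProbabilityMeasure (P₁ i)]
    {P₂ : ∀ i, Measure (Ω₂ i)} [∀ i, IsProbabilityMeasure (P₂ i)]
    {Q : Measure Ω₀} [IsProbabilityMeasure Q] {Q' : Measure Ω₀'} [IsProbabilityMeasure Q']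
    {X : ∀ i, Ω₁ i → E} {Y : ∀ i, Ω₂ i → E} {Z : Ω₀ → E} {W : Ω₀' → E}
    (h : TendstoInDistribution X l Z P₁ Q) (hXY : ∀ i, IdentDistrib (X i) (Y i) (P₁ i) (P₂ i))
    (hZW : IdentDistrib Z W Q Q') :
    TendstoInDistribution Y l W P₂ Q' where
  forall_aemeasurable i := (hXY i).aemeasurable_snd
  aemeasurable_limit := hZW.aemeasurable_snd
  tendsto := by
    have hlim : (⟨Q.map Z, Measure.isProbabilityMeasure_map h.aemeasurable_limit⟩ :
        ProbabilityMeasure E) = ⟨Q'.map W, Measure.isProbabilityMeasure_map hZW.aemeasurable_snd⟩ :=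
      Subtype.ext hZW.map_eq
    rw [← hlim]
    exact h.tendsto.congr fun i => Subtype.ext (hXY i).map_eq

/-- If `X i` and `Y i` differ with probability tending to zero, they have the same limit in
distribution; the probability space may depend on `i`. -/
theorem tendstoInDistribution_of_tendsto_measure_ne {ι E Ω' : Type*} {Ω₁ : ι → Type*}
    [∀ i, MeasurableSpace (Ω₁ i)] [MeasurableSpace Ω']
    [TopologicalSpace E] [MeasurableSpace E] [OpensMeasurableSpace E] {l : Filter ι}
    {P : ∀ i, Measure (Ω₁ i)} [∀ i, IsProbabilityMeasure (P i)]
    {Q : Measure Ω'} [IsProbabilityMeasure Q] {X Y : ∀ i, Ω₁ i → E} {Z : Ω' → E}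
    (h : TendstoInDistribution X l Z P Q) (hY : ∀ i, AEMeasurable (Y i) (P i))
    (hne : Tendsto (fun i => P i {ω | X i ω ≠ Y i ω}) l (nhds 0)) :
    TendstoInDistribution Y l Z P Q where
  forall_aemeasurable := hY
  aemeasurable_limit := h.aemeasurable_limit
  tendsto := by
    have hX := h.forall_aemeasurable
    have h1 := ProbabilityMeasure.tendsto_iff_forall_integral_tendsto.1 h.tendsto
    refine ProbabilityMeasure.tendsto_iff_forall_integral_tendsto.2 fun f => ?_
    refine (h1 f).congr_dist (squeeze_zero (fun _ => dist_nonneg) (g := fun i =>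
      2 * ‖f‖ * (P i).real {ω | X i ω ≠ Y i ω}) (fun i => ?_) ?_)
    · simp only [ProbabilityMeasure.coe_mk]
      rw [integral_map (hX i) f.continuous.measurable.aestronglyMeasurable,
        integral_map (hY i) f.continuous.measurable.aestronglyMeasurable]
      have hfX : Integrable (fun ω => f (X i ω)) (P i) := Integrable.of_bound
        ((f.continuous.measurable.comp_aemeasurable (hX i)).aestronglyMeasurable) ‖f‖
        (ae_of_all _ fun ω => f.norm_coe_le_norm _)
      have hfY : Integrable (fun ω => f (Y i ω)) (P i) := Integrable.of_bound
        ((f.continuous.measurable.comp_aemeasurable (hY i)).aestronglyMeasurable) ‖f‖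
        (ae_of_all _ fun ω => f.norm_coe_le_norm _)
      rw [dist_eq_norm, ← integral_sub hfX hfY]
      -- the set where the variables differ need not be measurable
      set T := toMeasurable (P i) {ω | X i ω ≠ Y i ω} with hT
      have hTm : MeasurableSet T := measurableSet_toMeasurable _ _
      calc ‖∫ ω, (f (X i ω) - f (Y i ω)) ∂(P i)‖
          ≤ ∫ ω, T.indicator (fun _ => 2 * ‖f‖) ω ∂(P i) := by
            refine norm_integral_le_of_norm_le ((integrable_const _).indicator hTm)
              (ae_of_all _ fun ω => ?_)
            by_cases hω : ω ∈ T
            · rw [Set.indicator_of_mem hω, two_mul]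
              exact (norm_sub_le _ _).trans
                (add_le_add (f.norm_coe_le_norm _) (f.norm_coe_le_norm _))
            · have : X i ω = Y i ω := by
                by_contra hne
                exact hω (subset_toMeasurable _ _ hne)
              rw [Set.indicator_of_notMem hω, this, sub_self, norm_zero]
        _ = 2 * ‖f‖ * (P i).real {ω | X i ω ≠ Y i ω} := by
            rw [integral_indicator_const _ hTm, hT, measureReal_def, measureReal_def,
              measure_toMeasurable, smul_eq_mul, mul_comm]
    · have h2 := (ENNReal.tendsto_toReal ENNReal.zero_ne_top).comp hne
      simpa [measureReal_def] using h2.const_mul (2 * ‖f‖)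

theorem measurable_ringInverse {R : Type*} [NormedRing R] [HasSummableGeomSeries R]
    [MeasurableSpace R] [BorelSpace R] : Measurable (Ring.inverse : R → R) := by
  classical
  have h : (Ring.inverse : R → R) = {x | IsUnit x}.piecewise Ring.inverse (fun _ => 0) := by
    ext x
    by_cases hx : IsUnit x
    · exact (Set.piecewise_eq_of_mem {x : R | IsUnit x} _ _ hx).symm
    · rw [Ring.inverse_non_unit _ hx]
      exact (Set.piecewise_eq_of_notMem {x : R | IsUnit x} Ring.inverse (fun _ => 0) hx).symm
  rw [h]
  refine ContinuousOn.measurable_piecewise ?_ continuousOn_const Units.isOpen.measurableSet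
  rintro x ⟨u, rfl⟩
  exact (NormedRing.inverse_continuousAt u).continuousWithinAt

end Convergence

/-! ### The multivariate central limit theorem -/

section CentralLimit

variable {α V : Type*} [MeasurableSpace α] [NormedAddCommGroup V] [InnerProductSpace ℝ V]
  [MeasurableSpace V] [BorelSpace V]

theorem charFun_map_eq_charFun_map_inner {Ω' : Type*} [MeasurableSpace Ω'] {P : Measure Ω'}
    [SecondCountableTopology V] {W : Ω' → V} (hW : AEMeasurable W P) (t : V) :
    charFun (P.map W) t = charFun (P.map fun ω => inner ℝ (W ω) t) 1 := by
  rw [charFun_apply, charFun_apply_real, integral_map hW (by fun_prop),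
    integral_map (by fun_prop) (by fun_prop)]
  simp

/-- Central limit theorem in a Euclidean space, reduced to the real one by applying it to the inner
products with each vector. The Gaussian limit is specified by its characteristic function, so that
a degenerate covariance is allowed. -/
theorem tendstoInDistribution_sqrt_smul_sampleMean [FiniteDimensional ℝ V] {μ : Measure α}
    [IsProbabilityMeasure μ] {ψ : α → V} (hψ : Measurable ψ) (hψ2 : MemLp ψ 2 μ)
    (hψ0 : ∫ a, ψ a ∂μ = 0) {G : Measure V} [IsProbabilityMeasure G]
    (hG : ∀ t, charFun G t = Complex.exp (-((∫ a, inner ℝ (ψ a) t ^ 2 ∂μ : ℝ) : ℂ) / 2)) :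
    TendstoInDistribution
      (fun (n : ℕ) (ω : ℕ → α) => Real.sqrt n • sampleMean ψ fun j : Fin n => ω j) atTop id
      (fun _ => Measure.infinitePi fun _ : ℕ => μ) G := by
  have : CompleteSpace V := FiniteDimensional.complete ℝ V
  have : SecondCountableTopology V := have := FiniteDimensional.proper_real V; inferInstance
  set Q := Measure.infinitePi fun _ : ℕ => μ
  have hmp := measurePreserving_eval_infinitePi (fun _ : ℕ => μ)
  have hmeas : ∀ n : ℕ, Measurable
      (fun (ω : ℕ → α) => Real.sqrt n • sampleMean ψ fun j : Fin n => ω j) := fun n =>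
    ((measurable_sampleMean hψ n).comp (by fun_prop)).const_smul _
  refine ⟨fun n => (hmeas n).aemeasurable, aemeasurable_id, ?_⟩
  refine ProbabilityMeasure.tendsto_iff_tendsto_charFun.2 fun t => ?_
  set X : ℕ → (ℕ → α) → ℝ := fun i ω => inner ℝ (ψ (ω i)) t with hX
  have hf : Measurable fun a => inner ℝ (ψ a) t := by fun_prop
  have hf2 : MemLp (fun a => inner ℝ (ψ a) t) 2 μ := hψ2.inner_const t
  have hmean : ∫ ω, X 0 ω ∂Q = 0 := by
    rw [integral_comp_eval_infinitePi hf.aestronglyMeasurable 0]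
    simp_rw [fun a => real_inner_comm t (ψ a)]
    rw [integral_inner (hψ2.integrable one_le_two), hψ0, inner_zero_right]
  have hvar : Var[X 0; Q] = ∫ a, inner ℝ (ψ a) t ^ 2 ∂μ := by
    have hX0 : AEMeasurable (X 0) Q :=
      (hf.comp (measurable_pi_apply (X := fun _ : ℕ => α) 0)).aemeasurable
    rw [variance_eq_integral hX0, hmean]
    simp only [sub_zero]
    exact integral_comp_eval_infinitePi (f := fun a => inner ℝ (ψ a) t ^ 2) (by fun_prop) 0
  have hind : iIndepFun X Q := iIndepFun_infinitePi fun _ => hf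
  have hclt := tendstoInDistribution_inv_sqrt_mul_sum_sub (P := Q) (X := X)
    (P' := gaussianReal 0 Var[X 0; Q].toNNReal) HasLaw.id (hf2.comp_measurePreserving (hmp 0)) hind
    (fun i => IdentDistrib.comp (f := fun ω : ℕ → α => ω i) (g := fun ω : ℕ → α => ω 0)
      ⟨(hmp i).measurable.aemeasurable, (hmp 0).measurable.aemeasurable,
        (hmp i).map_eq.trans (hmp 0).map_eq.symm⟩ hf)
  have h := ProbabilityMeasure.tendsto_iff_tendsto_charFun.1 hclt.tendsto 1
  simp only [ProbabilityMeasure.coe_mk, Measure.map_id] at h ⊢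
  rw [hG, ← hvar]
  rw [charFun_gaussianReal, hmean, Real.coe_toNNReal _ (variance_nonneg _ _)] at h
  convert h using 2 with n
  · rw [charFun_map_eq_charFun_map_inner (hmeas n).aemeasurable]
    congr 2
    ext ω
    simp only [sampleMean, real_inner_smul_left, sum_inner, mul_zero, sub_zero, hX,
      Fin.sum_univ_eq_sum_range (fun i => inner ℝ (ψ (ω i)) t), ← mul_assoc]
    congr 1
    rw [← div_eq_mul_inv, Real.sqrt_div_self]
  · congr 1
    simp [neg_div]

end CentralLimit

/-! ### The least squares loss of one block -/

section LeastSquares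

variable {V : Type*} [NormedAddCommGroup V] [InnerProductSpace ℝ V]

/-- The contribution `(e², e x, x ⊗ x)` of an observation with covariate `x` and error `e` to the
coefficients of the least squares loss as a quadratic function of `b - β`; the matrix `x x'` is
encoded as the rank-one operator `v ↦ ⟪x, v⟫ x`. -/
noncomputable def lossCoeff (z : V × ℝ) : ℝ × V × (V →L[ℝ] V) :=
  (z.2 ^ 2, z.2 • z.1, InnerProductSpace.rankOne ℝ z.1 z.1)

theorem continuous_rankOne_self : Continuous fun x : V => InnerProductSpace.rankOne ℝ x x :=
  (InnerProductSpace.rankOne ℝ).continuous.clm_apply continuous_id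

theorem continuous_lossCoeff : Continuous (lossCoeff : V × ℝ → ℝ × V × (V →L[ℝ] V)) :=
  (continuous_snd.pow 2).prodMk ((continuous_snd.smul continuous_fst).prodMk
    (continuous_rankOne_self.comp continuous_fst))

theorem sampleMean_lossCoeff {n : ℕ} (z : Fin n → V × ℝ) :
    sampleMean lossCoeff z = (sampleMean (fun z => z.2 ^ 2) z, sampleMean (fun z => z.2 • z.1) z,
      sampleMean (fun z => InnerProductSpace.rankOne ℝ z.1 z.1) z) := by
  simp only [sampleMean, lossCoeff]
  ext1
  · simp [Prod.fst_sum]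
  ext1 <;> simp [Prod.fst_sum, Prod.snd_sum]

theorem inner_sampleMean_rankOne {n : ℕ} (z : Fin n → V × ℝ) (u v : V) :
    inner ℝ u (sampleMean (fun z => InnerProductSpace.rankOne ℝ z.1 z.1) z v) =
      (n : ℝ)⁻¹ * ∑ j, inner ℝ (z j).1 u * inner ℝ (z j).1 v := by
  simp only [sampleMean, smul_apply, sum_apply,
    InnerProductSpace.rankOne_apply, real_inner_smul_right, inner_sum]
  congr 1
  exact Finset.sum_congr rfl fun j _ => by rw [real_inner_comm u, mul_comm]

theorem quadraticLoss_sampleMean_lossCoeff {n : ℕ} (z : Fin n → V × ℝ) (δ : V) :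
    quadraticLoss (sampleMean lossCoeff z) δ =
      (1 / (n : ℝ)) * ∑ j, ((z j).2 - inner ℝ δ (z j).1) ^ 2 := by
  rw [quadraticLoss, sampleMean_lossCoeff]
  simp only [inner_sampleMean_rankOne]
  simp only [sampleMean, real_inner_smul_right, inner_sum, smul_eq_mul, Finset.mul_sum, one_div]
  rw [← Finset.sum_sub_distrib, ← Finset.sum_add_distrib]
  refine Finset.sum_congr rfl fun j _ => ?_
  rw [real_inner_comm]
  ring

theorem inner_sampleMean_lossCoeff_symm {n : ℕ} (z : Fin n → V × ℝ) (u v : V) :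
    inner ℝ u ((sampleMean lossCoeff z).2.2 v) = inner ℝ ((sampleMean lossCoeff z).2.2 u) v := by
  rw [real_inner_comm v, sampleMean_lossCoeff, inner_sampleMean_rankOne, inner_sampleMean_rankOne]
  simp_rw [mul_comm]

variable [MeasurableSpace V]
  {ν : Measure V} {F : Measure ℝ}

theorem integral_snd_smul_fst [SFinite ν] [SFinite F] (hF0 : ∫ t, t ∂F = 0) :
    ∫ z : V × ℝ, z.2 • z.1 ∂(ν.prod F) = 0 := by
  rw [← integral_prod_swap]
  have h := integral_prod_smul (μ := F) (ν := ν) (fun t : ℝ => t) (fun x : V => x)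
  rw [hF0, zero_smul] at h
  exact h

variable [FiniteDimensional ℝ V] [BorelSpace V]

theorem integrable_rankOne_self (hν : MemLp id 2 ν) :
    Integrable (fun x : V => InnerProductSpace.rankOne ℝ x x) ν := by
  refine (hν.integrable_norm_pow two_ne_zero).mono' ?_ (ae_of_all _ fun x => ?_)
  · exact continuous_rankOne_self.aestronglyMeasurable
  · simp [pow_two]

theorem inner_integral_rankOne_self (hν : MemLp id 2 ν) (u v : V) :
    inner ℝ u ((∫ x, InnerProductSpace.rankOne ℝ x x ∂ν) v) = ∫ x, inner ℝ u x * inner ℝ x v ∂ν := by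
  have hint := integrable_rankOne_self hν
  rw [ContinuousLinearMap.integral_apply hint, ← integral_inner (hint.apply_continuousLinearMap v)]
  refine integral_congr_ae (ae_of_all _ fun x => ?_)
  simp [real_inner_smul_right, mul_comm]

theorem memLp_snd_smul_fst [SFinite ν] [SFinite F] (hν : MemLp id 2 ν) (hF : MemLp id 2 F) :
    MemLp (fun z : V × ℝ => z.2 • z.1) 2 (ν.prod F) := by
  have hm : AEStronglyMeasurable (fun z : V × ℝ => z.2 • z.1) (ν.prod F) := by fun_prop
  rw [← integrable_norm_rpow_iff hm (by norm_num) (by norm_num)]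
  have h := (hν.integrable_norm_pow two_ne_zero).mul_prod (hF.integrable_norm_pow two_ne_zero)
  refine h.congr (ae_of_all _ fun z => ?_)
  simp [norm_smul, mul_pow, mul_comm]

variable [IsProbabilityMeasure ν] [IsProbabilityMeasure F]

theorem integral_inner_snd_smul_fst_sq (hν : MemLp id 2 ν) (t : V) :
    ∫ z : V × ℝ, inner ℝ (z.2 • z.1) t ^ 2 ∂(ν.prod F) =
      errorVariance F * inner ℝ t ((∫ x, InnerProductSpace.rankOne ℝ x x ∂ν) t) := by
  rw [inner_integral_rankOne_self hν, mul_comm, errorVariance, ← integral_prod_mul]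
  refine integral_congr_ae (ae_of_all _ fun z => ?_)
  simp only [real_inner_smul_left]
  rw [real_inner_comm z.1 t]
  ring

theorem integrable_lossCoeff (hν : MemLp id 2 ν) (hF : MemLp id 2 F) :
    Integrable lossCoeff (ν.prod F) := by
  have h1 : Integrable (fun t : ℝ => t ^ 2) F := by simpa using hF.integrable_sq
  exact (h1.comp_snd ν).prodMk (((memLp_snd_smul_fst hν hF).integrable one_le_two).prodMk
    ((integrable_rankOne_self hν).comp_fst F))

theorem integral_lossCoeff (hν : MemLp id 2 ν) (hF : MemLp id 2 F) (hF0 : ∫ t, t ∂F = 0) :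
    ∫ z, lossCoeff z ∂(ν.prod F) =
      (errorVariance F, 0, ∫ x, InnerProductSpace.rankOne ℝ x x ∂ν) := by
  have h1 : Integrable (fun t : ℝ => t ^ 2) F := by simpa using hF.integrable_sq
  have h2 := (memLp_snd_smul_fst hν hF).integrable one_le_two
  have h3 := (integrable_rankOne_self hν).comp_fst F
  have h4 := integral_pair (h1.comp_snd ν) (h2.prodMk h3)
  rw [integral_pair h2 h3, integral_snd_smul_fst hF0,
    integral_fun_snd (μ := ν) (fun t : ℝ => t ^ 2),
    integral_fun_fst (ν := F) (fun x : V => InnerProductSpace.rankOne ℝ x x)] at h4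
  simpa [lossCoeff, errorVariance] using h4

/-- Asymptotic normality of the least squares error, whose limit is written as the inverse of the
second moment operator applied to a Gaussian vector with law `G`. Off the event that the empirical
second moment operator is invertible, an event of probability tending to one, `Ring.inverse` takes
the value `0`. -/
theorem tendstoInDistribution_ringInverse_sampleMean (hν : MemLp id 2 ν) (hF : MemLp id 2 F)
    (hF0 : ∫ t, t ∂F = 0) (hA : IsUnit (∫ x, InnerProductSpace.rankOne ℝ x x ∂ν))
    {G : Measure V} [IsProbabilityMeasure G]
    (hG : ∀ t, charFun G t = Complex.exp (-((errorVariance F *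
      inner ℝ t ((∫ x, InnerProductSpace.rankOne ℝ x x ∂ν) t) : ℝ) : ℂ) / 2)) :
    TendstoInDistribution (fun (n : ℕ) (ω : ℕ → V × ℝ) => Real.sqrt n •
      Ring.inverse (sampleMean lossCoeff fun j : Fin n => ω j).2.2
        (sampleMean lossCoeff fun j : Fin n => ω j).2.1) atTop
      (fun t => Ring.inverse (∫ x, InnerProductSpace.rankOne ℝ x x ∂ν) t)
      (fun _ => Measure.infinitePi fun _ : ℕ => ν.prod F) G := by
  have : CompleteSpace V := FiniteDimensional.complete ℝ V
  have hclt := tendstoInDistribution_sqrt_smul_sampleMean (μ := ν.prod F)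
    (ψ := fun z : V × ℝ => z.2 • z.1) (by fun_prop) (memLp_snd_smul_fst hν hF)
    (integral_snd_smul_fst hF0) (G := G)
    (fun t => by rw [hG, integral_inner_snd_smul_fst_sq hν])
  have hmeas : ∀ n : ℕ, Measurable fun ω : ℕ → V × ℝ =>
      Ring.inverse (sampleMean lossCoeff fun j : Fin n => ω j).2.2 := fun n =>
    measurable_ringInverse.comp (measurable_snd.comp (measurable_snd.comp
      ((measurable_sampleMean continuous_lossCoeff.measurable n).comp (by fun_prop))))
  have hinv : TendstoInMeasure (Measure.infinitePi fun _ : ℕ => ν.prod F)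
      (fun (n : ℕ) (ω : ℕ → V × ℝ) => Ring.inverse (sampleMean lossCoeff fun j : Fin n => ω j).2.2)
      atTop (fun _ => Ring.inverse (∫ x, InnerProductSpace.rankOne ℝ x x ∂ν)) := by
    refine tendstoInMeasure_of_tendsto_ae (fun n => (hmeas n).aestronglyMeasurable) ?_
    filter_upwards [ae_tendsto_sampleMean continuous_lossCoeff.measurable
      (integrable_lossCoeff hν hF)] with ω hω
    rw [integral_lossCoeff hν hF hF0] at hω
    obtain ⟨u, hu⟩ := hA
    have h := NormedRing.inverse_continuousAt u
    rw [hu] at h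
    exact h.tendsto.comp ((continuous_snd.comp continuous_snd).continuousAt.tendsto.comp hω)
  have h := TendstoInDistribution.continuous_comp_prodMk_of_tendstoInMeasure_const
    (g := fun q : V × (V →L[ℝ] V) => q.2 q.1) (by fun_prop) hclt hinv
    (fun n => (hmeas n).aemeasurable)
  refine h.congr (fun n => ae_of_all _ fun ω => ?_) (ae_of_all _ fun ω => rfl)
  simp only [map_smul, sampleMean_lossCoeff]

end LeastSquares

/-! ### Second moment matrices and Gaussian limits -/

section Euclidean

variable {p : ℕ}

theorem toEuclideanCLM_secondMomentMatrix {ν : Measure (EuclideanSpace ℝ (Fin p))}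
    (hν : MemLp id 2 ν) :
    Matrix.toEuclideanCLM (𝕜 := ℝ) (secondMomentMatrix ν) =
      ∫ x, InnerProductSpace.rankOne ℝ x x ∂ν := by
  have hcoord : ∀ a, MemLp (fun x : EuclideanSpace ℝ (Fin p) => x a) 2 ν := fun a => by
    simpa [EuclideanSpace.inner_single_right] using
      hν.inner_const (𝕜 := ℝ) (EuclideanSpace.single a (1 : ℝ))
  have hint : ∀ a b, Integrable (fun x : EuclideanSpace ℝ (Fin p) => x a * x b) ν := fun a b =>
    (hcoord a).integrable_mul (hcoord b)
  refine ContinuousLinearMap.ext fun v => ext_inner_left ℝ fun u => ?_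
  rw [Matrix.inner_toEuclideanCLM, inner_integral_rankOne_self hν]
  have hexp : ∀ x : EuclideanSpace ℝ (Fin p), inner ℝ u x * inner ℝ x v =
      ∑ a, ∑ b, u a * (x a * x b * v b) := fun x => by
    simp only [PiLp.inner_apply, RCLike.inner_apply, conj_trivial, Finset.sum_mul_sum]
    exact Finset.sum_congr rfl fun a _ => Finset.sum_congr rfl fun b _ => by ring
  simp_rw [hexp]
  rw [integral_finsetSum _ fun a _ => integrable_finsetSum _ fun b _ =>
    ((hint a b).mul_const _).const_mul _]
  refine Finset.sum_congr rfl fun a _ => ?_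
  rw [integral_finsetSum _ fun b _ => ((hint a b).mul_const _).const_mul _]
  simp only [Matrix.mulVec, dotProduct, secondMomentMatrix, Matrix.of_apply, Finset.mul_sum,
    integral_const_mul, integral_mul_const]

theorem Matrix.PosDef.ringInverse_toEuclideanCLM {M : Matrix (Fin p) (Fin p) ℝ} (hM : M.PosDef) :
    IsUnit (Matrix.toEuclideanCLM (𝕜 := ℝ) M) ∧
    Ring.inverse (Matrix.toEuclideanCLM (𝕜 := ℝ) M) = Matrix.toEuclideanCLM (𝕜 := ℝ) M⁻¹ := by
  have hdet : IsUnit M.det := hM.det_pos.ne'.isUnit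
  let u : (EuclideanSpace ℝ (Fin p) →L[ℝ] EuclideanSpace ℝ (Fin p))ˣ :=
    ⟨Matrix.toEuclideanCLM (𝕜 := ℝ) M, Matrix.toEuclideanCLM (𝕜 := ℝ) M⁻¹,
      by rw [← map_mul, Matrix.mul_nonsing_inv _ hdet, map_one],
      by rw [← map_mul, Matrix.nonsing_inv_mul _ hdet, map_one]⟩
  exact ⟨u.isUnit, Ring.inverse_unit u⟩

/-- `M⁻¹ (s M) M⁻¹ = s M⁻¹` for covariance matrices. -/
theorem map_toEuclideanCLM_inv_multivariateGaussian {M : Matrix (Fin p) (Fin p) ℝ} (hM : M.PosDef)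
    {s : ℝ} (hs : 0 ≤ s) :
    (multivariateGaussian 0 (s • M)).map (Matrix.toEuclideanCLM (𝕜 := ℝ) M⁻¹) =
      multivariateGaussian 0 (s • M⁻¹) := by
  have hdet : IsUnit M.det := hM.det_pos.ne'.isUnit
  have hsymm : ∀ u v, inner ℝ (Matrix.toEuclideanCLM (𝕜 := ℝ) M⁻¹ u) v =
      inner ℝ u (Matrix.toEuclideanCLM (𝕜 := ℝ) M⁻¹ v) := by
    have h : IsSelfAdjoint (Matrix.toEuclideanCLM (𝕜 := ℝ) M⁻¹) :=
      IsSelfAdjoint.map hM.inv.isHermitian.isSelfAdjoint _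
    exact fun u v => h.isSymmetric u v
  refine Measure.ext_of_charFun (funext fun t => ?_)
  have h1 : charFun ((multivariateGaussian 0 (s • M)).map (Matrix.toEuclideanCLM (𝕜 := ℝ) M⁻¹)) t =
      charFun (multivariateGaussian 0 (s • M)) (Matrix.toEuclideanCLM (𝕜 := ℝ) M⁻¹ t) := by
    rw [charFun_apply, charFun_apply, integral_map (by fun_prop) (by fun_prop)]
    simp_rw [hsymm]
  rw [h1, charFun_multivariateGaussian (hM.posSemidef.smul hs),
    charFun_multivariateGaussian (hM.inv.posSemidef.smul hs), ← Matrix.inner_toEuclideanCLM,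
    ← Matrix.inner_toEuclideanCLM, map_smul, map_smul, smul_apply,
    smul_apply, ← mul_apply_eq_comp, ← map_mul,
    Matrix.mul_nonsing_inv _ hdet, map_one, one_apply_eq_self]
  simp only [inner_zero_right, real_inner_smul_right]
  rw [hsymm]

theorem SublinearExpectation.IsPossibleLaw.memLp_id {Ω₀ : Type*} {𝔼 : SublinearExpectation Ω₀}
    {ε : 𝔼.space} (hε_sq : (fun ω => (ε : Ω₀ → ℝ) ω ^ 2) ∈ 𝔼.space) {F : Measure ℝ}
    (hF : 𝔼.IsPossibleLaw ε F) : MemLp id 2 F :=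
  (memLp_two_iff_integrable_sq (by fun_prop)).2 (hF (fun t => t ^ 2) (by fun_prop) hε_sq).1

/-- Mean-certainty of `ε` bounds both `∫ t` and `∫ -t` by `0`. -/
theorem SublinearExpectation.IsPossibleLaw.integral_eq_zero {Ω₀ : Type*}
    {𝔼 : SublinearExpectation Ω₀} {ε : 𝔼.space} (hε : 𝔼.IsMeanCertain ε) {F : Measure ℝ}
    (hF : 𝔼.IsPossibleLaw ε F) : ∫ t, t ∂F = 0 := by
  have h1 : ∫ t, t ∂F ≤ 𝔼.expect ε := (hF (fun t => t) measurable_id ε.2).2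
  have h2 : ∫ t, -t ∂F ≤ 𝔼.expect (-ε) := (hF (fun t => -t) measurable_neg (-ε).2).2
  rw [integral_neg] at h2
  have h3 : 𝔼.expect ε = 0 := hε.2
  have h4 : -𝔼.expect (-ε) = 0 := hε.1
  linarith

theorem blockLoss_eq_quadraticLoss {n : ℕ} {β : EuclideanSpace ℝ (Fin p)} {y e : Fin n → ℝ}
    {x : Fin n → EuclideanSpace ℝ (Fin p)} (hy : ∀ j, y j = inner ℝ β (x j) + e j)
    (δ : EuclideanSpace ℝ (Fin p)) :
    blockLoss y x (β + δ) = quadraticLoss (sampleMean lossCoeff fun j => (x j, e j)) δ := by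
  rw [quadraticLoss_sampleMean_lossCoeff, blockLoss]
  congr 1
  refine Finset.sum_congr rfl fun j _ => ?_
  rw [hy, inner_add_left]
  ring

end Euclidean

/-! ### The mini-max estimator -/

theorem theorem3p1 {p m : ℕ}
    -- the error `ε`, mean-certain with possibly uncertain variance
    {Ω₀ : Type*} (𝔼 : SublinearExpectation Ω₀) (ε : 𝔼.space)
    (hε_sq : (fun ω => (ε : Ω₀ → ℝ) ω ^ 2) ∈ 𝔼.space)
    (hε_mean : 𝔼.IsMeanCertain ε)
    -- the error distribution of each block, one of the possible distributions of `ε`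
    (F : Fin m → Measure ℝ) [∀ i, IsProbabilityMeasure (F i)]
    (hF : ∀ i, 𝔼.IsPossibleLaw ε (F i))
    -- the block with the strictly largest error variance
    (iStar : Fin m)
    (hStar : ∀ i, i ≠ iStar → errorVariance (F i) < errorVariance (F iStar))
    -- the certain distribution of the covariate
    (ν : Measure (EuclideanSpace ℝ (Fin p))) [IsProbabilityMeasure ν]
    (hν : MemLp id 2 ν) (hν_pos : (secondMomentMatrix ν).PosDef)
    -- the true parameter, interior to the parameter set
    (β : EuclideanSpace ℝ (Fin p)) (B : Set (EuclideanSpace ℝ (Fin p))) (hβ : β ∈ interior B)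
    -- the `k`-th sample consists of `m` blocks of `n k` observations
    (n : ℕ → ℕ) (hn : Tendsto n atTop atTop)
    {Ω : ℕ → Type*} [∀ k, MeasurableSpace (Ω k)]
    (P : ∀ k, Measure (Ω k)) [∀ k, IsProbabilityMeasure (P k)]
    (x : ∀ k, Fin m → Fin (n k) → Ω k → EuclideanSpace ℝ (Fin p))
    (e : ∀ k, Fin m → Fin (n k) → Ω k → ℝ)
    (Y : ∀ k, Fin m → Fin (n k) → Ω k → ℝ)
    (hY : ∀ k i j ω, Y k i j ω = inner ℝ β (x k i j ω) + e k i j ω)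
    (hx_law : ∀ k i j, HasLaw (x k i j) ν (P k))
    (hx_indep : ∀ k, iIndepFun (fun (ij : Fin m × Fin (n k)) => x k ij.1 ij.2) (P k))
    (he_law : ∀ k i j, HasLaw (e k i j) (F i) (P k))
    (he_indep : ∀ k i, iIndepFun (fun j => e k i j) (P k))
    (hxe_indep : ∀ k, IndepFun
      (fun ω (ij : Fin m × Fin (n k)) => x k ij.1 ij.2 ω)
      (fun ω (ij : Fin m × Fin (n k)) => e k ij.1 ij.2 ω) (P k))
    -- the mini-max estimator
    (βhat : ∀ k, Ω k → EuclideanSpace ℝ (Fin p))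
    (hβhat_meas : ∀ k, AEMeasurable (βhat k) (P k))
    (hβhat : ∀ k, ∀ᵐ ω ∂(P k),
      IsMinimaxEstimate B (fun i j => Y k i j ω) (fun i j => x k i j ω) (βhat k ω)) :
    TendstoInDistribution (fun k ω => Real.sqrt (n k) • (βhat k ω - β)) atTop id P
      (multivariateGaussian 0 (errorVariance (F iStar) • (secondMomentMatrix ν)⁻¹)) := by

  set μ : Fin m → Measure (EuclideanSpace ℝ (Fin p) × ℝ) := fun i => ν.prod (F i)
  set A := ∫ x, InnerProductSpace.rankOne ℝ x x ∂ν with hA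
  set s := errorVariance (F iStar) with hs
  have hs0 : 0 ≤ s := integral_nonneg fun t => sq_nonneg t
  have hF2 : ∀ i, MemLp id 2 (F i) := fun i => (hF i).memLp_id hε_sq
  have hF0 : ∀ i, ∫ t, t ∂(F i) = 0 := fun i => (hF i).integral_eq_zero hε_mean
  have hAM := toEuclideanCLM_secondMomentMatrix hν
  obtain ⟨hA_unit, hA_inv⟩ := hν_pos.ringInverse_toEuclideanCLM
  rw [hAM] at hA_unit hA_inv
  have hA_pos : ∀ v, v ≠ 0 → 0 < inner ℝ v (A v) := fun v hv => by
    rw [hA, ← hAM, Matrix.inner_toEuclideanCLM]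
    have hv' : v.ofLp ≠ 0 := fun h => hv (by ext a; exact congrFun h a)
    simpa using hν_pos.dotProduct_mulVec_pos hv'
  -- the least squares error of block `iStar`, as a function of the data of the block
  let T : ∀ n : ℕ, (Fin n → EuclideanSpace ℝ (Fin p) × ℝ) → EuclideanSpace ℝ (Fin p) := fun n z =>
    Real.sqrt n • Ring.inverse (sampleMean lossCoeff z).2.2 (sampleMean lossCoeff z).2.1
  have hmean_meas : ∀ n : ℕ, Measurable
      (sampleMean lossCoeff : (Fin n → EuclideanSpace ℝ (Fin p) × ℝ) → _) :=
    measurable_sampleMean continuous_lossCoeff.measurable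
  have hT_meas : ∀ n, Measurable (T n) := fun n => by
    have h1 := measurable_ringInverse.comp (measurable_snd.comp (measurable_snd.comp (hmean_meas n)))
    have h2 := measurable_fst.comp (measurable_snd.comp (hmean_meas n))
    have h3 : Continuous fun q : (EuclideanSpace ℝ (Fin p) →L[ℝ] EuclideanSpace ℝ (Fin p)) ×
      EuclideanSpace ℝ (Fin p) => q.1 q.2 := by fun_prop
    exact (h3.measurable.comp (h1.prodMk h2)).const_smul (Real.sqrt n)
  let z : ∀ k, Fin m → Ω k → Fin (n k) → EuclideanSpace ℝ (Fin p) × ℝ :=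
    fun k i ω j => (x k i j ω, e k i j ω)
  have hz : ∀ k i, HasLaw (z k i) (Measure.pi fun _ => μ i) (P k) := fun k i =>
    ((hx_indep k).precomp (g := fun j => (i, j))
      (Prod.mk_right_injective i)).hasLaw_pi_prod (hx_law k i) (he_indep k i) (he_law k i)
      ((hxe_indep k).comp
        (φ := fun (f : Fin m × Fin (n k) → EuclideanSpace ℝ (Fin p)) (j : Fin (n k)) => f (i, j))
        (ψ := fun (f : Fin m × Fin (n k) → ℝ) (j : Fin (n k)) => f (i, j))
        (by fun_prop) (by fun_prop))
  -- the least squares error is asymptotically normal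
  have hlim : TendstoInDistribution (fun k ω => T (n k) (z k iStar ω)) atTop id P
      (multivariateGaussian 0 (s • (secondMomentMatrix ν)⁻¹)) := by
    have h1 := tendstoInDistribution_ringInverse_sampleMean hν (hF2 iStar) (hF0 iStar) hA_unit
      (G := multivariateGaussian 0 (s • secondMomentMatrix ν)) (fun t => by
        rw [charFun_multivariateGaussian (hν_pos.posSemidef.smul hs0), ← Matrix.inner_toEuclideanCLM,
          map_smul, hAM, smul_apply, real_inner_smul_right]
        simp [hs, neg_div])
    have h2 : TendstoInDistribution (fun k (ω : ℕ → EuclideanSpace ℝ (Fin p) × ℝ) =>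
        T (n k) fun j => ω j) atTop (fun t => Ring.inverse A t)
        (fun _ => Measure.infinitePi fun _ => μ iStar)
        (multivariateGaussian 0 (s • secondMomentMatrix ν)) :=
      ⟨fun k => h1.forall_aemeasurable (n k), h1.aemeasurable_limit, h1.tendsto.comp hn⟩
    refine h2.congr_identDistrib (fun k => ?_) ⟨h1.aemeasurable_limit, aemeasurable_id, by
      rw [Measure.map_id, ← map_toEuclideanCLM_inv_multivariateGaussian hν_pos hs0, ← hA_inv]⟩
    exact IdentDistrib.comp (f := fun (ω : ℕ → EuclideanSpace ℝ (Fin p) × ℝ) (j : Fin (n k)) => ω j)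
      ⟨(measurable_pi_iff.2 fun j => measurable_pi_apply _).aemeasurable, (hz k iStar).aemeasurable,
        (map_restrict_infinitePi_eq_pi (μ iStar) (n k)).trans (hz k iStar).map_eq.symm⟩
      (hT_meas (n k))
  -- the mini-max error coincides with it with probability tending to one
  obtain ⟨η, hη, hdet⟩ := exists_forall_minimizer_eq_ringInverse
    (s := fun i => errorVariance (F i)) hStar hA_pos (D := (fun δ => β + δ) ⁻¹' B)
    ((by fun_prop : Continuous fun δ => β + δ).continuousAt.preimage_mem_nhds
      (by simpa using mem_interior_iff_mem_nhds.1 hβ))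
  have hbad : ∀ i, Tendsto (fun k => P k {ω | η ≤ ‖sampleMean lossCoeff (z k i ω) -
      (errorVariance (F i), 0, A)‖}) atTop (nhds 0) := fun i => by
    have h := (tendsto_measure_le_norm_sampleMean_sub (μ := μ i) continuous_lossCoeff.measurable
      (integrable_lossCoeff hν (hF2 i)) hη).comp hn
    rw [integral_lossCoeff hν (hF2 i) (hF0 i)] at h
    refine h.congr fun k => ?_
    exact ((hz k i).measure_eq
      (measurableSet_le measurable_const ((hmean_meas _).sub_const _).norm)).symm
  refine tendstoInDistribution_of_tendsto_measure_ne hlim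
    (fun k => ((hβhat_meas k).sub_const β).const_smul (Real.sqrt (n k))) ?_
  have hsum := tendsto_finsetSum Finset.univ fun i _ => hbad i
  rw [Finset.sum_const_zero] at hsum
  refine tendsto_of_tendsto_of_tendsto_of_le_of_le tendsto_const_nhds hsum (fun _ => zero_le)
    fun k => ?_
  refine le_trans (measure_mono_ae ?_) (measure_iUnion_fintype_le (P k) _)
  filter_upwards [hβhat k] with ω hω hne
  change ω ∈ ⋃ i, {ω | η ≤ ‖sampleMean lossCoeff (z k i ω) - (errorVariance (F i), 0, A)‖}
  by_contra hgood
  refine hne ?_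
  simp only [Set.mem_iUnion, Set.mem_ofPred_eq, not_exists, not_le] at hgood
  have hloss : ∀ δ, maxBlockLoss (fun i j => Y k i j ω) (fun i j => x k i j ω) (β + δ) =
      ⨆ i, quadraticLoss (sampleMean lossCoeff (z k i ω)) δ := fun δ =>
    iSup_congr fun i => blockLoss_eq_quadraticLoss (fun j => hY k i j ω) δ
  have h := hdet (fun i => sampleMean lossCoeff (z k i ω)) hgood
    (inner_sampleMean_lossCoeff_symm _) (βhat k ω - β) (by simpa using hω.1) (fun δ hδ => by
      have h := hω.2 hδ
      simp only [Set.mem_ofPred_eq] at h ⊢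
      rw [← hloss, ← hloss]
      simpa using h)
  simp only [T, h]
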